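/- There is a universal constant $C>0$ such that for all $\delta,\varepsilon\in(0,1)$ there exists an odd polynomial $p$ with real coefficients such that $$\deg p\le C\,\frac{1}{\sqrt{\delta}}\log\frac{1}{\delta\varepsilon},\qquad \max_{x\in[-1,1]}|p(x)|\le 1,\qquad \max_{x\in[-(1-\delta),\,1-\delta]}\Bigl|p(x)-\frac{2}{\pi}\arcsin(x)\Bigr|\le\varepsilon .$$ Here the zero polynomial counts as odd and as having degree $0$. -/

import Mathlib

open Polynomial

/-! With `x = cos θ`, the target becomes the triangle wave, bounded by 1 and affine on `[0, π]`.
Averaging it against a nonnegative kernel `K (cos t)`, with `K` of degree `2m`, gives a polynomial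
in `cos θ` of degree at most `2m`, still bounded by 1 (`exists_polynomial_eq_convolution`). Take `K
= T_m (y + δ) ^ 2`: it is at most 1 for `cos t ≤ 1 - δ`, yet its integral is at least of order `√δ *
exp (m√δ)` (`le_integral_peakKernel`). Where `K` is large, affinity makes the symmetric second
difference of the wave vanish, so the normalised error is `O(exp (-m√δ) / √δ)`. Then `m` of order
`log (1 / (δε)) / √δ` suffices, and taking the odd part finishes. -/

/-- The triangle wave with values in `[-1, 1]`: an even function equal to `1 - 2 t / π` on
`[0, π]`. -/
noncomputable def triangleWave (t : ℝ) : ℝ := 2 / Real.pi * Real.arcsin (Real.cos t)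

theorem continuous_triangleWave : Continuous triangleWave := by
  unfold triangleWave
  exact continuous_const.mul (Real.continuous_arcsin.comp Real.continuous_cos)

theorem periodic_triangleWave : Function.Periodic triangleWave (2 * Real.pi) := fun t => by
  simp [triangleWave]

theorem triangleWave_neg (t : ℝ) : triangleWave (-t) = triangleWave t := by
  simp [triangleWave]

theorem abs_two_div_pi_mul_arcsin_le_one (x : ℝ) : |2 / Real.pi * Real.arcsin x| ≤ 1 := by
  have h1 := Real.arcsin_le_pi_div_two x
  have h2 := Real.neg_pi_div_two_le_arcsin x
  have hpi := Real.pi_pos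
  rw [abs_mul, abs_of_pos (by positivity), div_mul_eq_mul_div, div_le_one hpi]
  have := abs_le.2 ⟨by linarith, h1⟩
  linarith

theorem abs_triangleWave_le_one (t : ℝ) : |triangleWave t| ≤ 1 :=
  abs_two_div_pi_mul_arcsin_le_one _

theorem triangleWave_eq_of_mem_Icc {t : ℝ} (ht : t ∈ Set.Icc 0 Real.pi) :
    triangleWave t = 1 - 2 / Real.pi * t := by
  have h := Real.arccos_cos ht.1 ht.2
  rw [Real.arccos] at h
  have hpi := Real.pi_pos
  rw [triangleWave, show Real.arcsin (Real.cos t) = Real.pi / 2 - t by linarith]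
  field_simp

/-! ### Convolution with polynomials in `cos t` -/

/-- Symmetrised convolution of a continuous `2π`-periodic even function with `cos (n t)` is a
multiple of `cos (n θ)`. -/
theorem integral_add_sub_mul_cos {G : ℝ → ℝ} (hG : Continuous G)
    (hper : Function.Periodic G (2 * Real.pi)) (heven : ∀ t, G (-t) = G t) (n : ℕ) (θ : ℝ) :
    ∫ t in -Real.pi..Real.pi, (G (θ + t) + G (θ - t)) * Real.cos (n * t) =
      (2 * ∫ s in -Real.pi..Real.pi, G s * Real.cos (n * s)) * Real.cos (n * θ) := by
  have key : ∀ a : ℝ, ∫ t in -Real.pi..Real.pi, G (t + a) * Real.cos (n * t) =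
      ∫ s in -Real.pi..Real.pi, G s * Real.cos (n * (s - a)) := by
    intro a
    have h1 := intervalIntegral.integral_comp_add_right (a := -Real.pi) (b := Real.pi)
      (fun s => G s * Real.cos (n * (s - a))) a
    simp only [add_sub_cancel_right] at h1
    have hp : Function.Periodic (fun s => G s * Real.cos (n * (s - a))) (2 * Real.pi) := by
      intro s
      simp only [hper s]
      rw [show (n : ℝ) * (s + 2 * Real.pi - a) = n * (s - a) + n * (2 * Real.pi) by ring,
        Real.cos_add_nat_mul_two_pi]
    have h2 := hp.intervalIntegral_add_eq (-Real.pi + a) (-Real.pi)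
    rw [show -Real.pi + a + 2 * Real.pi = Real.pi + a by ring,
      show -Real.pi + 2 * Real.pi = Real.pi by ring] at h2
    rw [h1, h2]
  have hrefl : ∀ t, G (θ - t) = G (t + -θ) := fun t => by
    rw [← heven]; congr 1; ring
  have hint : ∀ f : ℝ → ℝ, Continuous f →
      IntervalIntegrable f MeasureTheory.volume (-Real.pi) Real.pi :=
    fun f hf => hf.intervalIntegrable _ _
  simp only [hrefl, add_comm θ, add_mul]
  rw [intervalIntegral.integral_add (hint _ (by fun_prop)) (hint _ (by fun_prop)), key, key,
    ← intervalIntegral.integral_add (hint _ (by fun_prop)) (hint _ (by fun_prop)),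
    mul_comm (2 : ℝ), mul_assoc, ← intervalIntegral.integral_mul_const]
  refine intervalIntegral.integral_congr fun s _ => ?_
  simp only [sub_neg_eq_add]
  -- The sine products from the shifts by `θ` and `-θ` cancel.
  rw [mul_add (n : ℝ), mul_sub (n : ℝ), Real.cos_sub, Real.cos_add]
  ring

/-- Symmetrised convolution of a continuous `2π`-periodic even function with a polynomial in
`cos t` is a polynomial in `cos θ` of no larger degree. -/
theorem exists_polynomial_eq_convolution {G : ℝ → ℝ} (hG : Continuous G)
    (hper : Function.Periodic G (2 * Real.pi)) (heven : ∀ t, G (-t) = G t) (N : ℕ) (Q : ℝ[X])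
    (hQ : Q.natDegree ≤ N) :
    ∃ p : ℝ[X], p.natDegree ≤ N ∧ ∀ θ : ℝ, p.eval (Real.cos θ) =
      ∫ t in -Real.pi..Real.pi, (G (θ + t) + G (θ - t)) * Q.eval (Real.cos t) := by
  -- By linearity it suffices to treat `T_i`, for which `T_i (cos t) = cos (i t)`.
  have hmem : Q ∈ Submodule.span ℝ (Chebyshev.chebyshevTsequence ℝ '' Set.Iio (N + 1)) := by
    rw [Sequence.span_degreeLT]
    · rw [mem_degreeLT]
      exact (degree_le_of_natDegree_le hQ).trans_lt (by exact_mod_cast Nat.lt_succ_self N)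
    · intro i _
      exact isUnit_iff_ne_zero.2 (leadingCoeff_ne_zero.2 (Sequence.ne_zero _ i))
  clear hQ
  have hint : ∀ f : ℝ → ℝ, Continuous f →
      IntervalIntegrable f MeasureTheory.volume (-Real.pi) Real.pi :=
    fun f hf => hf.intervalIntegrable _ _
  induction hmem using Submodule.span_induction with
  | mem q hq =>
    obtain ⟨i, hi, rfl⟩ := hq
    refine ⟨C (2 * ∫ s in -Real.pi..Real.pi, G s * Real.cos (i * s)) * Chebyshev.T ℝ i, ?_, ?_⟩
    · refine (natDegree_C_mul_le _ _).trans ?_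
      rw [Chebyshev.natDegree_T]
      simp only [Set.mem_Iio] at hi
      omega
    · intro θ
      have h : ∀ t : ℝ, (Chebyshev.chebyshevTsequence ℝ i).eval (Real.cos t) =
          Real.cos (i * t) := fun t => by
        have h' := Chebyshev.T_real_cos t i
        rwa [Int.cast_natCast] at h'
      have h' := Chebyshev.T_real_cos θ i
      simp only [Int.cast_natCast] at h'
      simp only [h, eval_mul, eval_C, h']
      exact (integral_add_sub_mul_cos hG hper heven i θ).symm
  | zero => exact ⟨0, by simp, by simp⟩
  | add q r _ _ hq hr =>
    obtain ⟨a, ha, ha'⟩ := hq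
    obtain ⟨b, hb, hb'⟩ := hr
    refine ⟨a + b, natDegree_add_le_of_degree_le ha hb, fun θ => ?_⟩
    rw [eval_add, ha', hb',
      ← intervalIntegral.integral_add (hint _ (by fun_prop)) (hint _ (by fun_prop))]
    simp only [eval_add, mul_add]
  | smul c q _ hq =>
    obtain ⟨a, ha, ha'⟩ := hq
    refine ⟨C c * a, (natDegree_C_mul_le _ _).trans ha, fun θ => ?_⟩
    rw [eval_mul, eval_C, ha', ← intervalIntegral.integral_const_mul]
    refine intervalIntegral.integral_congr fun t _ => ?_
    simp only [eval_smul, smul_eq_mul]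
    ring

/-! ### The peak kernel -/

/-- The peak kernel `T_m (y + δ) ^ 2`. -/
noncomputable def peakKernel (m : ℕ) (δ : ℝ) : ℝ[X] := ((Chebyshev.T ℝ m).comp (X + C δ)) ^ 2

theorem natDegree_peakKernel_le (m : ℕ) (δ : ℝ) : (peakKernel m δ).natDegree ≤ 2 * m := by
  refine natDegree_pow_le.trans ?_
  gcongr
  refine natDegree_comp_le.trans ?_
  simp

theorem eval_peakKernel (m : ℕ) (δ y : ℝ) :
    (peakKernel m δ).eval y = ((Chebyshev.T ℝ m).eval (y + δ)) ^ 2 := by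
  simp [peakKernel]

theorem eval_peakKernel_nonneg (m : ℕ) (δ y : ℝ) : 0 ≤ (peakKernel m δ).eval y := by
  rw [eval_peakKernel]; positivity

theorem eval_peakKernel_le_one (m : ℕ) {δ y : ℝ} (hδ : 0 ≤ δ) (h1 : -1 ≤ y) (h2 : y ≤ 1 - δ) :
    (peakKernel m δ).eval y ≤ 1 := by
  rw [eval_peakKernel, sq_le_one_iff_abs_le_one]
  exact Chebyshev.abs_eval_T_real_le_one m (abs_le.2 ⟨by linarith, by linarith⟩)

/-- Near `t = 0` the argument satisfies `cos t + δ ≥ 1 + δ/2 ≥ cosh (√δ/2)`, and `T_m (cosh u) =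
cosh (m u)` grows exponentially in `m`. -/
theorem le_eval_peakKernel_cos (m : ℕ) {δ t : ℝ} (h0 : 0 < δ) (h1 : δ < 1)
    (ht : |t| ≤ Real.sqrt δ) :
    Real.exp (m * Real.sqrt δ) / 4 ≤ (peakKernel m δ).eval (Real.cos t) := by
  have hs := Real.sq_sqrt h0.le
  have ht2 : t ^ 2 ≤ δ := by
    rw [← hs, ← sq_abs]; gcongr
  have hcos := Real.one_sub_sq_div_two_le_cos (x := t)
  have hy : 1 + δ / 2 ≤ Real.cos t + δ := by linarith
  have hcosh : Real.cosh (Real.sqrt δ / 2) ≤ 1 + δ / 4 := by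
    refine (Real.cosh_le_exp_half_sq _).trans ?_
    have he : (Real.sqrt δ / 2) ^ 2 / 2 = δ / 8 := by rw [div_pow, hs]; ring
    have := Real.abs_exp_sub_one_le (x := δ / 8) (by rw [abs_of_pos (by linarith)]; linarith)
    rw [abs_of_pos (show (0 : ℝ) < δ / 8 by linarith)] at this
    rw [he]
    linarith [le_abs_self (Real.exp (δ / 8) - 1)]
  have hu := Real.cosh_arcosh (x := Real.cos t + δ) (by linarith)
  set u := Real.arcosh (Real.cos t + δ)
  rw [eval_peakKernel, ← hu, Chebyshev.T_real_cosh]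
  have hle : |Real.sqrt δ / 2| ≤ |u| := Real.cosh_le_cosh.1 (by linarith)
  have h2 : Real.cosh (m * (Real.sqrt δ / 2)) ≤ Real.cosh (m * u) := by
    rw [Real.cosh_le_cosh, abs_mul, abs_mul]
    gcongr
  have h3 : Real.exp (m * (Real.sqrt δ / 2)) / 2 ≤ Real.cosh (m * u) := by
    refine le_trans ?_ h2
    rw [Real.cosh_eq]
    linarith [Real.exp_pos (-(m * (Real.sqrt δ / 2)))]
  calc Real.exp (m * Real.sqrt δ) / 4 = (Real.exp (m * (Real.sqrt δ / 2)) / 2) ^ 2 := by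
        rw [div_pow, ← Real.exp_nat_mul]
        push_cast
        ring_nf
    _ ≤ _ := by
        push_cast
        gcongr

theorem le_integral_peakKernel (m : ℕ) {δ : ℝ} (h0 : 0 < δ) (h1 : δ < 1) :
    Real.sqrt δ * Real.exp (m * Real.sqrt δ) / 2 ≤
      ∫ t in -Real.pi..Real.pi, (peakKernel m δ).eval (Real.cos t) := by
  have hs : Real.sqrt δ ≤ 1 := Real.sqrt_le_one.2 h1.le
  have hs0 := Real.sqrt_nonneg δ
  have hpi := Real.pi_gt_three
  have hc : Continuous fun t => (peakKernel m δ).eval (Real.cos t) := by fun_prop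
  calc Real.sqrt δ * Real.exp (m * Real.sqrt δ) / 2
      = ∫ _ in -Real.sqrt δ..Real.sqrt δ, Real.exp (m * Real.sqrt δ) / 4 := by
        rw [intervalIntegral.integral_const, smul_eq_mul]; ring
    _ ≤ ∫ t in -Real.sqrt δ..Real.sqrt δ, (peakKernel m δ).eval (Real.cos t) := by
        refine intervalIntegral.integral_mono_on (by linarith) (by simp)
          (hc.intervalIntegrable _ _) fun t ht => ?_
        exact le_eval_peakKernel_cos m h0 h1 (abs_le.2 ht)
    _ ≤ _ := by
        refine intervalIntegral.integral_mono_interval (by linarith) (by linarith) (by linarith)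
          (Filter.Eventually.of_forall fun t => eval_peakKernel_nonneg _ _ _)
          (hc.intervalIntegrable _ _)

/-! ### Error of the averaged wave -/

/-- Where the peak kernel exceeds `1`, the second difference of the triangle wave vanishes. -/
theorem abs_secondDifference_mul_peakKernel_le (m : ℕ) {δ θ t : ℝ} (h0 : 0 < δ)
    (hθ : Real.cos θ ∈ Set.Icc (-(1 - δ)) (1 - δ)) (hθ' : θ ∈ Set.Icc 0 Real.pi)
    (ht : t ∈ Set.Icc (-Real.pi) Real.pi) :
    |(triangleWave (θ + t) + triangleWave (θ - t) - 2 * triangleWave θ) *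
      (peakKernel m δ).eval (Real.cos t)| ≤ 4 := by
  rcases le_or_gt (Real.cos t) (1 - δ) with hc | hc
  · rw [abs_mul, abs_of_nonneg (eval_peakKernel_nonneg m δ (Real.cos t))]
    have h1 := eval_peakKernel_le_one m h0.le (Real.neg_one_le_cos t) hc
    have a1 := abs_le.1 (abs_triangleWave_le_one (θ + t))
    have a2 := abs_le.1 (abs_triangleWave_le_one (θ - t))
    have a3 := abs_le.1 (abs_triangleWave_le_one θ)
    have a4 : |triangleWave (θ + t) + triangleWave (θ - t) - 2 * triangleWave θ| ≤ 4 :=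
      abs_le.2 ⟨by linarith, by linarith⟩
    nlinarith [eval_peakKernel_nonneg m δ (Real.cos t)]
  -- Since `cos t > 1 - δ ≥ |cos θ|`, both `θ + t` and `θ - t` stay in `[0, π]`, where the wave is
  -- affine.
  · have habs : |t| ∈ Set.Icc 0 Real.pi := ⟨abs_nonneg t, abs_le.2 ht⟩
    rw [← Real.cos_abs] at hc
    have b1 : |t| ≤ θ := by
      by_contra! h
      have := Real.cos_le_cos_of_nonneg_of_le_pi hθ'.1 habs.2 h.le
      linarith [hθ.2]
    have b2 : |t| ≤ Real.pi - θ := by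
      by_contra! h
      have := Real.cos_le_cos_of_nonneg_of_le_pi (by linarith [hθ'.2]) habs.2 h.le
      rw [Real.cos_pi_sub] at this
      linarith [hθ.1]
    have c1 := abs_le.1 b1
    have c2 := abs_le.1 b2
    rw [triangleWave_eq_of_mem_Icc hθ', triangleWave_eq_of_mem_Icc ⟨by linarith, by linarith⟩,
      triangleWave_eq_of_mem_Icc ⟨by linarith, by linarith⟩]
    ring_nf
    norm_num

theorem exists_polynomial_approx_arcsin (m : ℕ) {δ : ℝ} (h0 : 0 < δ) (h1 : δ < 1) :
    ∃ p : ℝ[X], p.natDegree ≤ 2 * m ∧ (∀ x ∈ Set.Icc (-1 : ℝ) 1, |p.eval x| ≤ 1) ∧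
      ∀ x ∈ Set.Icc (-(1 - δ)) (1 - δ), |p.eval x - 2 / Real.pi * Real.arcsin x| ≤
        8 * Real.pi / (Real.sqrt δ * Real.exp (m * Real.sqrt δ)) := by
  obtain ⟨p, hdeg, hp⟩ := exists_polynomial_eq_convolution continuous_triangleWave
    periodic_triangleWave triangleWave_neg (2 * m) (peakKernel m δ) (natDegree_peakKernel_le m δ)
  have hI := le_integral_peakKernel m h0 h1
  set I := ∫ t in -Real.pi..Real.pi, (peakKernel m δ).eval (Real.cos t) with hIdef
  have hE : 0 < Real.sqrt δ * Real.exp (m * Real.sqrt δ) := by positivity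
  have hIpos : 0 < I := by linarith
  have hpi := Real.pi_pos
  have hcont := continuous_triangleWave
  -- The factor 2 appears because the symmetrised convolution counts the kernel's mass twice.
  refine ⟨C (1 / (2 * I)) * p, (natDegree_C_mul_le _ _).trans hdeg, fun x hx => ?_, fun x hx => ?_⟩
  · have hcos := Real.cos_arccos hx.1 hx.2
    rw [eval_mul, eval_C, ← hcos, hp, abs_mul, abs_of_pos (by positivity), one_div,
      inv_mul_le_one₀ (by positivity), hIdef, ← intervalIntegral.integral_const_mul]
    refine (intervalIntegral.abs_integral_le_integral_abs (by linarith)).trans ?_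
    refine intervalIntegral.integral_mono_on (by linarith)
      (Continuous.intervalIntegrable (by fun_prop) _ _)
      (Continuous.intervalIntegrable (by fun_prop) _ _) fun t _ => ?_
    rw [abs_mul, abs_of_nonneg (eval_peakKernel_nonneg m δ (Real.cos t))]
    refine mul_le_mul_of_nonneg_right ((abs_add_le _ _).trans ?_) (eval_peakKernel_nonneg _ _ _)
    linarith [abs_triangleWave_le_one (Real.arccos x + t),
      abs_triangleWave_le_one (Real.arccos x - t)]
  · have hcos := Real.cos_arccos (x := x) (by linarith [hx.1]) (by linarith [hx.2])
    set θ := Real.arccos x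
    have hθ' : θ ∈ Set.Icc 0 Real.pi := ⟨Real.arccos_nonneg x, Real.arccos_le_pi x⟩
    have hrw : 2 / Real.pi * Real.arcsin x = triangleWave θ := by rw [triangleWave, hcos]
    have hbound : |p.eval x - 2 * I * triangleWave θ| ≤ 4 * (2 * Real.pi) := by
      have hdiff : p.eval x - 2 * I * triangleWave θ = ∫ t in -Real.pi..Real.pi,
          (triangleWave (θ + t) + triangleWave (θ - t) - 2 * triangleWave θ) *
            (peakKernel m δ).eval (Real.cos t) := by
        rw [← hcos, hp, show 2 * I * triangleWave θ = (2 * triangleWave θ) * I by ring, hIdef,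
          ← intervalIntegral.integral_const_mul, ← intervalIntegral.integral_sub
            (Continuous.intervalIntegrable (by fun_prop) _ _)
            (Continuous.intervalIntegrable (by fun_prop) _ _)]
        simp only [sub_mul]
      rw [hdiff]
      have := intervalIntegral.norm_integral_le_of_norm_le_const (a := -Real.pi) (b := Real.pi)
        (C := 4) (f := fun t =>
          (triangleWave (θ + t) + triangleWave (θ - t) - 2 * triangleWave θ) *
            (peakKernel m δ).eval (Real.cos t)) fun t ht => by
          rw [Set.uIoc_of_le (by linarith)] at ht
          exact abs_secondDifference_mul_peakKernel_le m h0 (hcos.symm ▸ hx) hθ'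
            ⟨ht.1.le, ht.2⟩
      rw [Real.norm_eq_abs, sub_neg_eq_add, abs_of_pos (show 0 < Real.pi + Real.pi by linarith)]
        at this
      linarith
    rw [hrw, eval_mul, eval_C, show 1 / (2 * I) * p.eval x - triangleWave θ =
      (p.eval x - 2 * I * triangleWave θ) / (2 * I) by field_simp, abs_div,
      abs_of_pos (show 0 < 2 * I by linarith)]
    calc _ ≤ 4 * (2 * Real.pi) / (Real.sqrt δ * Real.exp (m * Real.sqrt δ)) := by
          exact div_le_div₀ (by positivity) hbound hE (by linarith)
      _ = _ := by ring

/-! ### Odd part and choice of `m` -/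

/-- The odd part of a polynomial approximates an odd function as well as the polynomial does. -/
theorem exists_odd_polynomial_of_odd {f : ℝ → ℝ} (hf : Function.Odd f) (p : ℝ[X]) {a e : ℝ}
    (hbound : ∀ x ∈ Set.Icc (-1 : ℝ) 1, |p.eval x| ≤ 1)
    (happrox : ∀ x ∈ Set.Icc (-a) a, |p.eval x - f x| ≤ e) :
    ∃ q : ℝ[X], Function.Odd (fun x : ℝ => q.eval x) ∧ q.natDegree ≤ p.natDegree ∧
      (∀ x ∈ Set.Icc (-1 : ℝ) 1, |q.eval x| ≤ 1) ∧
      ∀ x ∈ Set.Icc (-a) a, |q.eval x - f x| ≤ e := by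
  have heval : ∀ x, (C (1 / 2) * (p - p.comp (-X))).eval x = (p.eval x - p.eval (-x)) / 2 := by
    intro x
    simp only [eval_mul, eval_C, eval_sub, eval_comp, eval_neg, eval_X]
    ring
  refine ⟨C (1 / 2) * (p - p.comp (-X)), fun x => ?_, ?_, fun x hx => ?_, fun x hx => ?_⟩
  · simp only [heval, neg_neg]
    ring
  · refine (natDegree_C_mul_le _ _).trans ((natDegree_sub_le _ _).trans (max_le le_rfl ?_))
    exact natDegree_comp_le.trans (by simp)
  · have h1 := abs_le.1 (hbound x hx)
    have h2 := abs_le.1 (hbound (-x) ⟨by linarith [hx.2], by linarith [hx.1]⟩)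
    rw [heval, abs_le]
    constructor <;> linarith
  · have h1 := abs_le.1 (happrox x hx)
    have h2 := abs_le.1 (happrox (-x) ⟨by linarith [hx.2], by linarith [hx.1]⟩)
    rw [hf] at h2
    rw [heval, abs_le]
    constructor <;> linarith

theorem corollary3p6 :
    ∃ C : ℝ, 0 < C ∧ ∀ δ ∈ Set.Ioo (0 : ℝ) 1, ∀ ε ∈ Set.Ioo (0 : ℝ) 1,
      ∃ p : ℝ[X],
        Function.Odd (fun x : ℝ => p.eval x) ∧
        (p.natDegree : ℝ) ≤ C * ((1 / Real.sqrt δ) * Real.log (1 / (δ * ε))) ∧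
        (∀ x ∈ Set.Icc (-1 : ℝ) 1, |p.eval x| ≤ 1) ∧
        (∀ x ∈ Set.Icc (-(1 - δ)) (1 - δ),
          |p.eval x - 2 / Real.pi * Real.arcsin x| ≤ ε) := by
  -- `16 = 2 * (6 + 2)`: the degree is at most `2m`, with 6 from `log (32 / (δε)) ≤ 6Λ` and 2 from
  -- rounding `m` up.
  refine ⟨16, by norm_num, fun δ ⟨hδ0, hδ1⟩ ε ⟨hε0, hε1⟩ => ?_⟩
  have hpi := Real.pi_pos
  have hprod : 0 < δ * ε := mul_pos hδ0 hε0
  have hs0 : 0 < Real.sqrt δ := Real.sqrt_pos.2 hδ0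
  have hs1 : Real.sqrt δ ≤ 1 := Real.sqrt_le_one.2 hδ1.le
  have hodd : Function.Odd fun x : ℝ => 2 / Real.pi * Real.arcsin x := fun x => by
    simp [Real.arcsin_neg]
  -- For `δε` near 1 the logarithm is too small to absorb the rounding of `m`; there `|x| ≤ 1/2`,
  -- the target is at most `1/3 < ε`, and the zero polynomial works.
  rcases le_or_gt (1 / 2) (δ * ε) with hbig | hsmall
  · refine ⟨0, fun x => by simp, ?_, by simp, fun x hx => ?_⟩
    · have : 0 ≤ Real.log (1 / (δ * ε)) :=
        Real.log_nonneg ((one_le_div hprod).2 (by nlinarith))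
      simp only [natDegree_zero, Nat.cast_zero]
      positivity
    · have hδ : 1 / 2 ≤ δ := by nlinarith
      have hε : 1 / 2 ≤ ε := by nlinarith
      have hmem : ∀ y : ℝ, y ≤ 1 / 2 → Real.arcsin y ≤ Real.pi / 6 := fun y hy => by
        refine (Real.monotone_arcsin hy).trans (le_of_eq ?_)
        rw [← Real.sin_pi_div_six]
        exact Real.arcsin_sin (by linarith) (by linarith)
      have a1 := hmem x (by linarith [hx.2])
      have a2 := hmem (-x) (by linarith [hx.1])
      rw [Real.arcsin_neg] at a2
      have a3 : |Real.arcsin x| ≤ Real.pi / 6 := abs_le.2 ⟨by linarith, a1⟩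
      rw [eval_zero, zero_sub, abs_neg, abs_mul, abs_of_pos (by positivity)]
      calc 2 / Real.pi * |Real.arcsin x| ≤ 2 / Real.pi * (Real.pi / 6) := by gcongr
        _ = 1 / 3 := by field_simp; norm_num
        _ ≤ ε := by linarith
  · set Λ := Real.log (1 / (δ * ε)) with hΛ
    have hlog2 : Real.log 2 ≤ Λ :=
      Real.log_le_log (by norm_num) ((le_div_iff₀ hprod).2 (by linarith))
    have hlog32 : Real.log (32 / (δ * ε)) = 5 * Real.log 2 + Λ := by
      rw [show (32 : ℝ) / (δ * ε) = 2 ^ 5 * (1 / (δ * ε)) by ring,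
        Real.log_mul (by positivity) (by positivity), Real.log_pow, ← hΛ]
      norm_num
    have hl2 := Real.log_two_gt_d9
    -- The 32 dominates the `8π` of the error bound, and the `δ` absorbs its `1 / √δ`.
    set m := ⌈Real.log (32 / (δ * ε)) / Real.sqrt δ⌉₊ with hm
    obtain ⟨p, hdeg, hbound, happrox⟩ := exists_polynomial_approx_arcsin m hδ0 hδ1
    obtain ⟨q, hqodd, hqdeg, hqbound, hqapprox⟩ :=
      exists_odd_polynomial_of_odd hodd p hbound happrox
    refine ⟨q, hqodd, ?_, hqbound, fun x hx => (hqapprox x hx).trans ?_⟩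
    · have h1 : (m : ℝ) < Real.log (32 / (δ * ε)) / Real.sqrt δ + 1 :=
        Nat.ceil_lt_add_one (div_nonneg (by rw [hlog32]; linarith) hs0.le)
      have h2 : Real.log (32 / (δ * ε)) / Real.sqrt δ ≤ 6 * Λ / Real.sqrt δ := by
        gcongr
        linarith
      have h3 : 1 ≤ 2 * Λ / Real.sqrt δ := (one_le_div hs0).2 (by linarith)
      have h4 : (q.natDegree : ℝ) ≤ 2 * m := by exact_mod_cast hqdeg.trans hdeg
      have h5 : 16 * (1 / Real.sqrt δ * Λ) =
          2 * (6 * Λ / Real.sqrt δ + 2 * Λ / Real.sqrt δ) := by ring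
      linarith
    · have h1 : Real.log (32 / (δ * ε)) ≤ m * Real.sqrt δ :=
        (div_le_iff₀ hs0).1 (Nat.le_ceil _)
      have h2 : 32 / (δ * ε) ≤ Real.exp (m * Real.sqrt δ) :=
        (Real.log_le_iff_le_exp (by positivity)).1 h1
      have h3 : δ ≤ Real.sqrt δ := by nlinarith [Real.sq_sqrt hδ0.le]
      rw [div_le_iff₀ (by positivity)]
      calc 8 * Real.pi ≤ 32 := by linarith [Real.pi_le_four]
        _ = ε * (δ * (32 / (δ * ε))) := by field_simp
        _ ≤ ε * (Real.sqrt δ * Real.exp (m * Real.sqrt δ)) := by gcongr
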